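/- Let $\alpha>-1$ be a real number and $K$ a positive integer. For $n\ge 0$ let $$\hat L_n^\alpha(x)=(-1)^n n!\,L_n^\alpha(x),\qquad L_n^\alpha(x)=\sum_{k=0}^n\binom{n+\alpha}{n-k}\frac{(-x)^k}{k!},$$ be the monic Laguerre polynomials. Given $K$ real numbers $\theta_1,\dots,\theta_K$ with $\theta_i<\alpha+1$ for $1\le i\le K$, define $\Phi_j^K$, $0\le j\le K$, by $$(x-\theta_1)\cdots(x-\theta_K)=\sum_{j=0}^K\Phi_j^K x^{K-j},$$ and $\gamma_j$, $0\le j\le K$, by $$\gamma_j=(-1)^j\sum_{i=0}^j(-1)^iS(K-j+i,K-j)\,\Phi_{j-i}^K,$$ where $S(n,k)$ denote the Stirling numbers of the second kind (so $\gamma_0=1$). Write $(x)_s=x(x+1)\cdots(x+s-1)$, $(x)_0=1$. Then the polynomial $Q(x)=\sum_{j=0}^K(-1)^j\gamma_j(x)_{K-j}$ is equal to $\prod_{i=1}^K(x-\theta_i)$. Moreover, for every $n\ge K$ all the (complex) zeros of the polynomial $$q_n(x)=\sum_{j=0}^K\gamma_j\hat L_{n-j}^\alpha(x)$$ are real, positive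 and simple, and for all sufficiently large $n$ the zeros of $q_{n+1}$ interlace the zeros of $q_n$. Here a finite set $U$ of real numbers strictly interlaces a finite set $V$ of real numbers if $\min U<\min V$ (in particular both sets are non-empty) and between any two consecutive elements of either of the two sets there is an element of the other one; $U$ interlaces $V$ if $U\setminus V$ strictly interlaces $V\setminus U$. -/

import Mathlib

open Polynomial

noncomputable section

/-- The Laguerre polynomial
`L_n^α(x) = ∑_{k=0}^n binom(n+α, n-k) (-x)^k / k!`, where the (generalized) binomial coefficient is
`binom(n+α, n-k) = (α+k+1)(α+k+2)⋯(α+n) / (n-k)!`. -/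
def laguerre (α : ℝ) (n : ℕ) : ℝ[X] :=
  ∑ k ∈ Finset.range (n + 1),
    C ((-1) ^ k * ((ascPochhammer ℝ (n - k)).eval (α + k + 1) / (n - k).factorial)
      / k.factorial) * X ^ k

/-- The monic Laguerre polynomial `(-1)^n n! L_n^α`
(the leading coefficient of `L_n^α` is `(-1)^n / n!`). -/
def monicLaguerre (α : ℝ) (n : ℕ) : ℝ[X] :=
  C ((-1) ^ n * (n.factorial : ℝ)) * laguerre α n

/-- `Φ_j^K`: the coefficient of `x^(K-j)` in `(x - θ_1)⋯(x - θ_K)`, for `0 ≤ j ≤ K`. -/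
def Phi {K : ℕ} (θ : Fin K → ℝ) (j : ℕ) : ℝ :=
  (∏ i, (X - C (θ i))).coeff (K - j)

/-- `γ_j = (-1)^j ∑_{i=0}^j (-1)^i S(K-j+i, K-j) Φ_{j-i}^K`, for `0 ≤ j ≤ K`, where `S` denotes
the Stirling numbers of the second kind. -/
def gammaCoeff {K : ℕ} (θ : Fin K → ℝ) (j : ℕ) : ℝ :=
  (-1) ^ j * ∑ i ∈ Finset.range (j + 1),
    (-1) ^ i * (Nat.stirlingSecond (K - j + i) (K - j) : ℝ) * Phi θ (j - i)

/-- `Q(x) = ∑_{j=0}^K (-1)^j γ_j (x)_{K-j}`, with `(x)_s = x(x+1)⋯(x+s-1)`. -/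
def polyQ (K : ℕ) (γ : ℕ → ℝ) : ℝ[X] :=
  ∑ j ∈ Finset.range (K + 1), C ((-1) ^ j * γ j) * ascPochhammer ℝ (K - j)

/-- `q_n(x) = ∑_{j=0}^K γ_j \hat L_{n-j}^α(x)`, for `n ≥ K`. -/
def lagComb (α : ℝ) (K : ℕ) (γ : ℕ → ℝ) (n : ℕ) : ℝ[X] :=
  ∑ j ∈ Finset.range (K + 1), C (γ j) * monicLaguerre α (n - j)

/-- All the zeros (in `ℂ`) of the real polynomial `p` are positive real numbers and simple. -/
def ZerosPositiveSimple (p : ℝ[X]) : Prop :=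
  ∀ z : ℂ, (p.map (algebraMap ℝ ℂ)).IsRoot z →
    (∃ x : ℝ, 0 < x ∧ z = (x : ℂ)) ∧ (p.map (algebraMap ℝ ℂ)).rootMultiplicity z = 1

/-- `a < b` are consecutive elements of the finite set `U`. -/
def ConsecutiveIn (U : Finset ℝ) (a b : ℝ) : Prop :=
  a ∈ U ∧ b ∈ U ∧ a < b ∧ ∀ c ∈ U, ¬ (a < c ∧ c < b)

/-- `U` strictly interlaces `V`: `min U < min V` (in particular both are non-empty), and between
any two consecutive elements of any of the two sets there is an element of the other one. -/
def StrictlyInterlaces (U V : Finset ℝ) : Prop :=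
  (∃ (hU : U.Nonempty) (hV : V.Nonempty), U.min' hU < V.min' hV) ∧
  (∀ a b, ConsecutiveIn U a b → ∃ c ∈ V, a < c ∧ c < b) ∧
  (∀ a b, ConsecutiveIn V a b → ∃ c ∈ U, a < c ∧ c < b)

/-- `U` interlaces `V`: after removing the common elements, `U` strictly interlaces `V`. -/
def Interlaces (U V : Finset ℝ) : Prop :=
  StrictlyInterlaces (U \ V) (V \ U)

end

/-! Expanding the powers of x in rising factorials, with Stirling coefficients, gives `Q = ∏ (x -
θ_i)`.

For the zeros, let `T = lagShift (α + 1 + m)`. Since `T - i = lagShift (α + 1 + m + i)` raises the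
monic Laguerre polynomial of degree m + i by one degree, the falling factorial of order s in T sends
the one of degree m to that of degree m + s. Hence `q_{m+K}` is a polynomial in T applied to the
monic Laguerre polynomial of degree m, and by the formula for Q it is `∏ (T + θ_i)`
(`lagComb_eq_aeval`). Each factor is a `lagShift` with parameter α + 1 + m - θ_i > 0, and such an
operator keeps zeros positive and simple, adding one (`exists_lagShift`).

Interlacing follows once `q_{n+1}` and `q_n'` have opposite signs at the zeros z of `q_n`. Write a_k
for the monic Laguerre values at z. For large n the top term dominates when z ≥ 6n, so z < 6n; the
recurrence run backwards gives n^j a_{n-j} = O(n a_{n-1}), and `q_n(z) = 0` makes a_n = O(a_{n-1}).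
Then `q_{n+1}(z)` is -n² a_{n-1} and z `q_n'(z)` is +n² a_{n-1}, up to O(n a_{n-1})
(`laguerreRec_mul_neg`). -/

/-! ### Stirling numbers and the factorization of Q -/

/-- Powers in terms of rising factorials, through Stirling numbers of the second kind. -/
lemma X_pow_eq_sum_stirlingSecond_ascPochhammer (m : ℕ) :
    (X : ℝ[X]) ^ m = ∑ k ∈ Finset.range (m + 1),
      C ((-1) ^ (m + k) * (Nat.stirlingSecond m k : ℝ)) * ascPochhammer ℝ k := by
  induction m with
  | zero => simp
  | succ m ih =>
    have hX : ∀ k : ℕ, (X : ℝ[X]) * ascPochhammer ℝ k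
        = ascPochhammer ℝ (k + 1) - C (k : ℝ) * ascPochhammer ℝ k := by
      intro k
      rw [ascPochhammer_succ_right, map_natCast]
      ring
    have h1 : (X : ℝ[X]) ^ (m + 1) = ∑ k ∈ Finset.range (m + 1),
        C ((-1) ^ (m + k) * (Nat.stirlingSecond m k : ℝ)) * ascPochhammer ℝ (k + 1)
        - ∑ k ∈ Finset.range (m + 1),
        C ((-1) ^ (m + k) * (Nat.stirlingSecond m k : ℝ) * k) * ascPochhammer ℝ k := by
      rw [pow_succ', ih, Finset.mul_sum, ← Finset.sum_sub_distrib]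
      refine Finset.sum_congr rfl fun k _ => ?_
      rw [mul_left_comm, hX, C_mul (b := (k : ℝ))]
      ring
    -- Index shift: the k = 0 term dies from the factor k, the added top term from S(m, m+1) = 0.
    have h2 : ∑ k ∈ Finset.range (m + 1),
        C ((-1) ^ (m + k) * (Nat.stirlingSecond m k : ℝ) * k) * ascPochhammer ℝ k
        = ∑ k ∈ Finset.range (m + 1), C ((-1) ^ (m + (k + 1)) *
          (Nat.stirlingSecond m (k + 1) : ℝ) * ((k + 1 : ℕ) : ℝ)) * ascPochhammer ℝ (k + 1) := by
      have h3 := Finset.sum_range_succ' (fun k : ℕ =>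
        C ((-1) ^ (m + k) * (Nat.stirlingSecond m k : ℝ) * k) * ascPochhammer ℝ k) (m + 1)
      rw [Finset.sum_range_succ, Nat.stirlingSecond_eq_zero_of_lt (Nat.lt_succ_self m)] at h3
      simpa using h3
    rw [h1, h2, Finset.sum_range_succ' _ (m + 1), ← Finset.sum_sub_distrib]
    simp only [Nat.stirlingSecond_succ_zero, Nat.cast_zero, mul_zero, map_zero, zero_mul, add_zero]
    refine Finset.sum_congr rfl fun k _ => ?_
    rw [Nat.stirlingSecond_succ_succ, ← sub_mul, ← C_sub]
    congr 2
    push_cast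
    ring

theorem polyQ_gammaCoeff {K : ℕ} (θ : Fin K → ℝ) :
    polyQ K (gammaCoeff θ) = ∏ i, (X - C (θ i)) := by
  have hdeg : (∏ i, (X - C (θ i))).natDegree = K := by
    rw [natDegree_prod_of_monic _ _ fun i _ => monic_X_sub_C (θ i)]
    simp
  conv_rhs => rw [as_sum_range_C_mul_X_pow (∏ i, (X - C (θ i))), hdeg]
  simp_rw [X_pow_eq_sum_stirlingSecond_ascPochhammer, Finset.mul_sum]
  -- Exchanging the sums over k ≤ m ≤ K collects the coefficient of each rising factorial (x)_k;
  -- with j = K - k and i = m - k it is (-1)^j γ_j.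
  rw [Finset.sum_comm' (t' := Finset.range (K + 1)) (s' := fun k => Finset.Ico k (K + 1))
    (by intro x y; simp only [Finset.mem_range, Finset.mem_Ico]; omega)]
  rw [polyQ, ← Finset.sum_range_reflect]
  refine Finset.sum_congr rfl fun k hk => ?_
  have hk' : k ≤ K := by simpa [Nat.lt_succ_iff] using hk
  rw [Finset.sum_Ico_eq_sum_range]
  have e1 : K + 1 - 1 - k = K - k := by omega
  have e2 : K - (K - k) = k := by omega
  have e3 : K + 1 - k = K - k + 1 := by omega
  rw [e1, e2, e3, gammaCoeff, e2, ← mul_assoc, ← mul_pow, neg_one_mul, neg_neg, one_pow, one_mul,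
    map_sum, Finset.sum_mul]
  refine Finset.sum_congr rfl fun i hi => ?_
  have hi' : i ≤ K - k := by simpa [Nat.lt_succ_iff] using hi
  have e4 : K - (K - k - i) = k + i := by omega
  rw [Phi, e4, ← mul_assoc, ← C_mul]
  congr 2
  rw [show k + i + k = i + 2 * k by ring, pow_add, pow_mul]
  norm_num
  ring

/-! ### The raising operator and Laguerre identities -/

/-- The operator `p ↦ (x - a) p - x p'`; up to the weight `x^(a-1) e^(-x)` it is minus the
derivative of `x^a e^(-x) p`. -/
noncomputable def lagShift (a : ℝ) : ℝ[X] →ₗ[ℝ] ℝ[X] where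
  toFun p := (X - C a) * p - X * derivative p
  map_add' p q := by rw [derivative_add]; ring
  map_smul' r p := by
    simp only [smul_eq_C_mul, derivative_C_mul, RingHom.id_apply]
    ring

lemma lagShift_apply (a : ℝ) (p : ℝ[X]) :
    lagShift a p = (X - C a) * p - X * derivative p := rfl

/-- The parameter enters only through a scalar multiple of p, so linear factors in one `lagShift`
are again `lagShift`s. -/
lemma lagShift_sub (c t : ℝ) : lagShift (c - t) = lagShift c + algebraMap ℝ (Module.End ℝ ℝ[X]) t := by
  refine LinearMap.ext fun p => ?_
  simp only [lagShift_apply, LinearMap.add_apply, Module.algebraMap_end_apply, smul_eq_C_mul,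
    C_sub]
  ring

lemma lagShift_add (c t : ℝ) : lagShift (c + t) = lagShift c - algebraMap ℝ (Module.End ℝ ℝ[X]) t := by
  rw [← sub_neg_eq_add, lagShift_sub, map_neg, sub_eq_add_neg]

lemma coeff_monicLaguerre (α : ℝ) (k d : ℕ) :
    (monicLaguerre α (k + d)).coeff k
      = (-1) ^ d * ((k + d).choose k : ℝ) * (ascPochhammer ℝ d).eval (α + k + 1) := by
  rw [monicLaguerre, coeff_C_mul, laguerre, finsetSum_coeff]
  simp only [coeff_C_mul, coeff_X_pow]
  rw [Finset.sum_eq_single k]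
  · have h1 : ((k + d).choose k : ℝ) * k.factorial * d.factorial = (k + d).factorial := by
      have := Nat.choose_mul_factorial_mul_factorial (Nat.le_add_right k d)
      rw [Nat.add_sub_cancel_left] at this
      exact_mod_cast this
    have hk : (k.factorial : ℝ) ≠ 0 := by positivity
    have hd : (d.factorial : ℝ) ≠ 0 := by positivity
    have h2 : ((-1 : ℝ) ^ k) * (-1) ^ k = 1 := by rw [← mul_pow]; norm_num
    rw [Nat.add_sub_cancel_left, if_pos rfl, ← h1, pow_add]
    field_simp
    linear_combination (((k + d).choose k : ℝ)
      * (ascPochhammer ℝ d).eval (α + k + 1)) * h2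
  · intro b _ hb
    rw [if_neg (Ne.symm hb), mul_zero]
  · intro h
    exact absurd (Finset.mem_range.2 (by omega)) h

lemma coeff_monicLaguerre_of_lt (α : ℝ) {n k : ℕ} (h : n < k) :
    (monicLaguerre α n).coeff k = 0 := by
  rw [monicLaguerre, coeff_C_mul, laguerre, finsetSum_coeff]
  simp only [coeff_C_mul, coeff_X_pow]
  rw [Finset.sum_eq_zero, mul_zero]
  intro b hb
  rw [if_neg (by have := Finset.mem_range.1 hb; omega), mul_zero]

lemma monicLaguerre_zero (α : ℝ) : monicLaguerre α 0 = 1 := by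
  simp [monicLaguerre, laguerre]

lemma X_mul_derivative_monicLaguerre (α : ℝ) (n : ℕ) :
    X * derivative (monicLaguerre α (n + 1))
      = C ((n : ℝ) + 1) * monicLaguerre α (n + 1)
        + C (((n : ℝ) + 1) * (n + 1 + α)) * monicLaguerre α n := by
  have hc : ∀ (p : ℝ[X]) (k : ℕ), (X * derivative p).coeff k = k * p.coeff k := by
    intro p k
    cases k with
    | zero => simp
    | succ k => rw [coeff_X_mul, coeff_derivative]; push_cast; ring
  ext k
  rw [hc, coeff_add, coeff_C_mul, coeff_C_mul]
  rcases lt_trichotomy k (n + 1) with h | h | h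
  · obtain ⟨d, rfl⟩ := Nat.exists_eq_add_of_le (Nat.lt_succ_iff.1 h)
    rw [add_assoc k d 1, coeff_monicLaguerre, coeff_monicLaguerre, ascPochhammer_succ_eval]
    have h1 : ((k + (d + 1)).choose k : ℝ) * (d + 1) = (k + d + 1) * ((k + d).choose k : ℝ) := by
      have h2 := Nat.add_one_mul_choose_eq (k + d) k
      have h3 := Nat.choose_succ_right_eq (k + d + 1) k
      rw [show k + d + 1 - k = d + 1 by omega] at h3
      rw [← h2] at h3
      rw [← add_assoc]
      exact_mod_cast h3.symm
    push_cast
    linear_combination (-(-1) ^ (d + 1) * (ascPochhammer ℝ d).eval (α + k + 1)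
      * (α + k + 1 + d)) * h1
  · subst h
    rw [coeff_monicLaguerre_of_lt α (Nat.lt_succ_self n)]
    push_cast
    ring
  · rw [coeff_monicLaguerre_of_lt α h, coeff_monicLaguerre_of_lt α (by omega : n < k)]
    ring

/-- On coefficients this is Pascal's rule plus absorption. The parameter grows with n, which is why
falling factorials of a single operator appear. -/
lemma lagShift_monicLaguerre (α : ℝ) (n : ℕ) :
    lagShift (α + 1 + n) (monicLaguerre α n) = monicLaguerre α (n + 1) := by
  have hc : ∀ (p : ℝ[X]) (k : ℕ), (X * derivative p).coeff k = k * p.coeff k := by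
    intro p k
    cases k with
    | zero => simp
    | succ k => rw [coeff_X_mul, coeff_derivative]; push_cast; ring
  ext k
  rw [lagShift_apply, sub_mul, coeff_sub, coeff_sub, hc, coeff_C_mul]
  cases k with
  | zero =>
    have h1 := coeff_monicLaguerre α 0 n
    have h2 := coeff_monicLaguerre α 0 (n + 1)
    rw [zero_add] at h1 h2
    rw [h1, h2, ascPochhammer_succ_eval, mul_coeff_zero]
    simp
    ring
  | succ k =>
    rw [coeff_X_mul]
    rcases lt_trichotomy k n with h | h | h
    · obtain ⟨d, rfl⟩ := Nat.exists_eq_add_of_le (Nat.succ_le_of_lt h)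
      have e1 : k + 1 + d = k + (d + 1) := by ring
      have e2 : k + 1 + d + 1 = (k + 1) + (d + 1) := by ring
      have c1 := coeff_monicLaguerre α k (d + 1)
      have c2 := coeff_monicLaguerre α (k + 1) d
      have c3 := coeff_monicLaguerre α (k + 1) (d + 1)
      rw [← e1] at c1
      rw [← e2] at c3
      have a1 : (ascPochhammer ℝ (d + 1)).eval (α + k + 1)
          = (α + k + 1) * (ascPochhammer ℝ d).eval (α + (k + 1 : ℕ) + 1) := by
        rw [ascPochhammer_succ_left, eval_mul, eval_X, eval_comp, eval_add, eval_X, eval_one]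
        push_cast
        ring_nf
      rw [Nat.succ_eq_add_one, c1, c2, c3, a1, ascPochhammer_succ_eval]
      push_cast
      have h1 : ((k + 1 + d + 1).choose (k + 1) : ℝ)
          = (k + 1 + d).choose k + (k + 1 + d).choose (k + 1) := by
        exact_mod_cast Nat.choose_succ_succ (k + 1 + d) k
      have h2 : ((k + 1 + d).choose (k + 1) : ℝ) * (k + 1) = (k + 1 + d).choose k * (d + 1) := by
        have h3 := Nat.choose_succ_right_eq (k + 1 + d) k
        rw [show k + 1 + d - k = d + 1 by omega] at h3
        exact_mod_cast h3
      rw [h1]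
      linear_combination ((-1) ^ (d) * (ascPochhammer ℝ d).eval (α + (k + 1) + 1)) * -h2
    · subst h
      have c1 := coeff_monicLaguerre α k 0
      have c2 := coeff_monicLaguerre α (k + 1) 0
      rw [coeff_monicLaguerre_of_lt α (Nat.lt_succ_self k)]
      simp at c1 c2
      rw [c1, c2]
      simp
    · rw [coeff_monicLaguerre_of_lt α h, coeff_monicLaguerre_of_lt α (by omega : n < k + 1),
        coeff_monicLaguerre_of_lt α (by omega : n + 1 < k + 1)]
      ring

lemma monicLaguerre_one (α : ℝ) : monicLaguerre α 1 = X - C (α + 1) := by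
  rw [← zero_add 1, ← lagShift_monicLaguerre, monicLaguerre_zero, lagShift_apply]
  simp

/-- The three-term recurrence. -/
lemma monicLaguerre_add_two (α : ℝ) (n : ℕ) :
    monicLaguerre α (n + 2) = (X - C (2 * n + 3 + α)) * monicLaguerre α (n + 1)
      - C (((n : ℝ) + 1) * (n + 1 + α)) * monicLaguerre α n := by
  have h1 := lagShift_monicLaguerre α (n + 1)
  rw [lagShift_apply, X_mul_derivative_monicLaguerre] at h1
  rw [← h1]
  simp only [map_add, map_mul]
  push_cast
  simp only [map_add, map_natCast, map_one, C_ofNat]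
  ring

/-- Applying `∏ (lagShift c - i)` to `L_m` raises the degree. -/
lemma aeval_descPochhammer_monicLaguerre (α : ℝ) (m s : ℕ) :
    aeval (lagShift (α + 1 + m)) (descPochhammer ℝ s) (monicLaguerre α m)
      = monicLaguerre α (m + s) := by
  induction s with
  | zero => simp
  | succ s ih =>
    rw [descPochhammer_succ_right, mul_comm, map_mul, Module.End.mul_apply, ih,
      map_sub, aeval_X, ← add_assoc, ← lagShift_monicLaguerre, ← map_natCast C s, aeval_C,
      ← lagShift_add]
    push_cast
    rw [add_assoc]

/-- The substitution x → -x in the formula for Q turns rising factorials into falling ones. -/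
lemma sum_gammaCoeff_descPochhammer {K : ℕ} (θ : Fin K → ℝ) :
    ∑ j ∈ Finset.range (K + 1), C (gammaCoeff θ j) * descPochhammer ℝ (K - j)
      = ∏ i, (X + C (θ i)) := by
  refine Polynomial.funext fun r => ?_
  have h := congrArg (eval (-r)) (polyQ_gammaCoeff θ)
  rw [polyQ, eval_finsetSum, eval_prod] at h
  rw [eval_finsetSum, eval_prod]
  have h2 : ∏ i, (X + C (θ i)).eval r = (-1) ^ K * ∏ i, (X - C (θ i)).eval (-r) := by
    have : (-1 : ℝ) ^ K = ∏ _i : Fin K, (-1 : ℝ) := by simp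
    rw [this, ← Finset.prod_mul_distrib]
    refine Finset.prod_congr rfl fun i _ => ?_
    simp
    ring
  rw [h2, ← h, Finset.mul_sum]
  refine Finset.sum_congr rfl fun j hj => ?_
  have hj' : j ≤ K := by simpa [Nat.lt_succ_iff] using hj
  rw [eval_mul, eval_mul, eval_C, eval_C, ascPochhammer_eval_neg_eq_descPochhammer]
  obtain ⟨d, rfl⟩ := Nat.exists_eq_add_of_le hj'
  rw [Nat.add_sub_cancel_left, pow_add]
  have h3 : ((-1 : ℝ) ^ j) * (-1) ^ j = 1 := by rw [← mul_pow]; norm_num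
  have h4 : ((-1 : ℝ) ^ d) * (-1) ^ d = 1 := by rw [← mul_pow]; norm_num
  linear_combination (-gammaCoeff θ j * eval r (descPochhammer ℝ d)) *
    ((-1 : ℝ) ^ d * (-1) ^ d * h3 + h4)

lemma lagComb_eq_aeval (α : ℝ) {K : ℕ} (θ : Fin K → ℝ) (m : ℕ) :
    lagComb α K (gammaCoeff θ) (m + K)
      = aeval (lagShift (α + 1 + m)) (∏ i, (X + C (θ i))) (monicLaguerre α m) := by
  rw [← sum_gammaCoeff_descPochhammer, map_sum, LinearMap.sum_apply, lagComb]
  refine Finset.sum_congr rfl fun j hj => ?_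
  have hj' : j ≤ K := by simpa [Nat.lt_succ_iff] using hj
  rw [map_mul, Module.End.mul_apply, aeval_C, Module.algebraMap_end_apply,
    aeval_descPochhammer_monicLaguerre, smul_eq_C_mul, Nat.add_sub_assoc hj']

/-! ### Polynomials with simple positive zeros, and interlacing -/

/-- `p` is the monic polynomial of degree `n` with the simple zeros `t 1 < ⋯ < t n`, all greater
than `t 0 = 0`. -/
structure PosChain (p : ℝ[X]) (n : ℕ) (t : ℕ → ℝ) : Prop where
  zero : t 0 = 0
  lt_succ : ∀ i < n, t i < t (i + 1)
  eq_prod : p = ∏ i ∈ Finset.range n, (X - C (t (i + 1)))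

namespace PosChain

variable {p h : ℝ[X]} {n : ℕ} {t s : ℕ → ℝ}

lemma lt (hp : PosChain p n t) {a b : ℕ} (hab : a < b) (hb : b ≤ n) : t a < t b := by
  induction b, hab using Nat.le_induction with
  | base => exact hp.lt_succ a hb
  | succ b hab ih => exact (ih (by omega)).trans (hp.lt_succ b hb)

lemma pos (hp : PosChain p n t) {i : ℕ} (hi : i < n) : 0 < t (i + 1) := by
  rw [← hp.zero]
  exact hp.lt (Nat.succ_pos i) hi

lemma monic (hp : PosChain p n t) : p.Monic := by
  rw [hp.eq_prod]
  exact monic_prod_of_monic _ _ fun i _ => monic_X_sub_C _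

lemma natDegree (hp : PosChain p n t) : p.natDegree = n := by
  rw [hp.eq_prod, natDegree_prod_of_monic _ _ fun i _ => monic_X_sub_C _]
  simp

lemma isRoot_iff (hp : PosChain p n t) (x : ℝ) : p.IsRoot x ↔ ∃ i < n, x = t (i + 1) := by
  rw [hp.eq_prod, IsRoot.def, eval_prod, Finset.prod_eq_zero_iff]
  simp [sub_eq_zero]

lemma mem_roots_toFinset (hp : PosChain p n t) (x : ℝ) :
    x ∈ p.roots.toFinset ↔ ∃ i < n, x = t (i + 1) := by
  rw [Multiset.mem_toFinset, mem_roots hp.monic.ne_zero, hp.isRoot_iff]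

lemma separable (hp : PosChain p n t) : p.Separable := by
  rw [hp.eq_prod]
  refine separable_prod_X_sub_C_iff'.2 fun x hx y hy hxy => ?_
  have hx' := Finset.mem_range.1 hx
  have hy' := Finset.mem_range.1 hy
  rcases lt_trichotomy x y with h | h | h
  · exact absurd hxy (hp.lt (Nat.succ_lt_succ h) hy').ne
  · exact h
  · exact absurd hxy (hp.lt (Nat.succ_lt_succ h) hx').ne'

lemma zerosPositiveSimple (hp : PosChain p n t) : ZerosPositiveSimple p := by
  intro z hz
  constructor
  · have hz' := hz
    rw [hp.eq_prod, IsRoot.def, Polynomial.map_prod, eval_prod, Finset.prod_eq_zero_iff] at hz'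
    obtain ⟨i, hi, hz'⟩ := hz'
    refine ⟨t (i + 1), hp.pos (Finset.mem_range.1 hi), ?_⟩
    simpa [sub_eq_zero] using hz'
  · have hne : p.map (algebraMap ℝ ℂ) ≠ 0 := (hp.monic.map _).ne_zero
    exact le_antisymm (rootMultiplicity_le_one_of_separable hp.separable.map z)
      ((rootMultiplicity_pos hne).2 hz)

lemma eval_zero_pos (hp : PosChain p n t) : 0 < (-1) ^ n * p.eval 0 := by
  have h1 : (-1 : ℝ) ^ n = ∏ _i ∈ Finset.range n, (-1 : ℝ) := by simp
  rw [hp.eq_prod, eval_prod, h1, ← Finset.prod_mul_distrib]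
  refine Finset.prod_pos fun i hi => ?_
  have := hp.pos (Finset.mem_range.1 hi)
  simpa using this

/-- At a simple zero the derivative is the product of the differences to the other zeros; n - j - 1
of them are negative. -/
lemma derivative_sign (hp : PosChain p n t) {j : ℕ} (hj : j < n) :
    0 < (-1) ^ (n + j + 1) * (derivative p).eval (t (j + 1)) := by
  obtain ⟨d, rfl⟩ := Nat.exists_eq_add_of_le (Nat.succ_le_of_lt hj)
  have h1 : (derivative p).eval (t (j + 1))
      = (∏ i ∈ Finset.range j, (t (j + 1) - t (i + 1))) *
        ∏ i ∈ Finset.range d, (t (j + 1) - t (j + 1 + i + 1)) := by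
    rw [hp.eq_prod, Finset.prod_range_add, Finset.prod_range_succ]
    simp [derivative_mul, eval_prod]
  have h2 : (-1 : ℝ) ^ (j.succ + d + j + 1) = ∏ _i ∈ Finset.range d, (-1 : ℝ) := by
    rw [show j.succ + d + j + 1 = d + 2 * (j + 1) by rw [Nat.succ_eq_add_one]; ring, pow_add,
      pow_mul]
    simp
  rw [h1, h2, mul_left_comm, ← Finset.prod_mul_distrib]
  refine mul_pos (Finset.prod_pos fun i hi => ?_) (Finset.prod_pos fun i hi => ?_)
  · have := hp.lt (Nat.succ_lt_succ (Finset.mem_range.1 hi)) hj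
    exact sub_pos.2 this
  · have := Finset.mem_range.1 hi
    have := hp.lt (by omega : j + 1 < j + 1 + i + 1) (by omega)
    linarith

/-- Opposite signs of `h` and `p'` at the zeros of `p`, and the right sign at `0`, force the
zeros of `h` to be positive, simple and separated by those of `p`. -/
theorem exists_interlacing (hp : PosChain p n t) (hm : h.Monic) (hd : h.natDegree = n + 1)
    (hsign : ∀ i < n, h.eval (t (i + 1)) * (derivative p).eval (t (i + 1)) < 0)
    (h0 : 0 < (-1) ^ (n + 1) * h.eval 0) :
    ∃ s, PosChain h (n + 1) s ∧ ∀ i < n, s (i + 1) < t (i + 1) ∧ t (i + 1) < s (i + 2) := by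
  -- The signs of h alternate along 0 = t 0 < t 1 < ⋯ < t n and end with h (t n) < 0, so the n
  -- intervals and the ray beyond t n supply n + 1 zeros.
  have hsgn : ∀ i ≤ n, 0 < (-1) ^ (n + 1 + i) * h.eval (t i) := by
    intro i hi
    cases i with
    | zero => rw [hp.zero]; exact h0
    | succ i =>
      have h1 := hp.derivative_sign hi
      have h2 := hsign i hi
      rw [show n + 1 + (i + 1) = (n + i + 1) + 1 by ring, pow_succ]
      rcases neg_one_pow_eq_or ℝ (n + i + 1) with e | e <;> rw [e] at h1 ⊢ <;> nlinarith
  obtain ⟨R, hR, hhR⟩ : ∃ R, t n < R ∧ 0 < h.eval R := by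
    have hdeg : 0 < h.degree := natDegree_pos_iff_degree_pos.1 (by omega)
    have ht := h.tendsto_atTop_of_leadingCoeff_nonneg hdeg (by rw [hm.leadingCoeff]; norm_num)
    exact ((Filter.eventually_gt_atTop (t n)).and (ht.eventually_gt_atTop 0)).exists
  have hroot : ∀ i, ∃ u, i ≤ n → t i < u ∧ (i < n → u < t (i + 1)) ∧ h.eval u = 0 := by
    intro i
    by_cases hi : i ≤ n
    swap
    · exact ⟨0, fun h => absurd h hi⟩
    obtain ⟨b, hb, hbn, hs⟩ : ∃ b, t i < b ∧ (i < n → b = t (i + 1)) ∧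
        h.eval (t i) * h.eval b < 0 := by
      have h1 := hsgn i hi
      rcases hi.lt_or_eq with hlt | heq
      · refine ⟨t (i + 1), hp.lt_succ i hlt, fun _ => rfl, ?_⟩
        have h2 := hsgn (i + 1) hlt
        rw [← add_assoc, pow_succ] at h2
        rcases neg_one_pow_eq_or ℝ (n + 1 + i) with e | e <;> rw [e] at h1 h2 <;> nlinarith
      · subst heq
        refine ⟨R, hR, fun h => absurd h (lt_irrefl _), ?_⟩
        rw [show i + 1 + i = 2 * i + 1 by ring, pow_succ, pow_mul] at h1
        norm_num at h1
        nlinarith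
    have hcont : ContinuousOn (fun x => h.eval x) (Set.Icc (t i) b) := h.continuous.continuousOn
    have h3 : ∃ u ∈ Set.Ioo (t i) b, h.eval u = 0 := by
      rcases mul_neg_iff.1 hs with ⟨h1, h2⟩ | ⟨h1, h2⟩
      · exact intermediate_value_Ioo' hb.le hcont ⟨h2, h1⟩
      · exact intermediate_value_Ioo hb.le hcont ⟨h1, h2⟩
    obtain ⟨u, hu, hu0⟩ := h3
    exact ⟨u, fun _ => ⟨hu.1, fun hin => hbn hin ▸ hu.2, hu0⟩⟩
  choose u hu using hroot
  let s : ℕ → ℝ := fun i => Nat.casesOn i 0 u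
  have hs0 : s 0 = 0 := rfl
  have hsS : ∀ i, s (i + 1) = u i := fun _ => rfl
  have hlt : ∀ i < n + 1, s i < s (i + 1) := by
    intro i hi
    rw [hsS]
    cases i with
    | zero => rw [hs0, ← hp.zero]; exact (hu 0 (by omega)).1
    | succ i =>
      rw [hsS]
      exact ((hu i (by omega)).2.1 (by omega)).trans (hu (i + 1) (by omega)).1
  have hinc : ∀ a b, a < b → b ≤ n + 1 → s a < s b := by
    intro a b hab
    induction b, hab using Nat.le_induction with
    | base => exact fun hb => hlt a hb
    | succ b hab ih => exact fun hb => (ih (by omega)).trans (hlt b hb)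
  refine ⟨s, ⟨hs0, hlt, ?_⟩, fun i hi => ?_⟩
  -- The n + 1 distinct zeros found exhaust the degree of h.
  · have hdvd : ∏ i ∈ Finset.range (n + 1), (X - C (s (i + 1))) ∣ h := by
      refine Finset.prod_dvd_of_coprime (fun i hi j hj hij => ?_) fun i hi => ?_
      · refine isCoprime_X_sub_C_of_isUnit_sub (IsUnit.mk0 _ (sub_ne_zero.2 ?_))
        have hi' := Finset.mem_range.1 hi
        have hj' := Finset.mem_range.1 hj
        rcases lt_or_gt_of_ne hij with h | h
        · exact (hinc _ _ (Nat.succ_lt_succ h) hj').ne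
        · exact (hinc _ _ (Nat.succ_lt_succ h) hi').ne'
      · rw [dvd_iff_isRoot]
        exact (hu i (by have := Finset.mem_range.1 hi; omega)).2.2
    refine (eq_of_monic_of_dvd_of_natDegree_le
      (monic_prod_of_monic _ _ fun i _ => monic_X_sub_C _) hm hdvd ?_)
    rw [natDegree_prod_of_monic _ _ fun i _ => monic_X_sub_C _, hd]
    simp
  · rw [hsS, hsS]
    exact ⟨(hu i hi.le).2.1 hi, (hu (i + 1) hi).1⟩

/-- The zeros alternate as s 1 < t 1 < s 2 < ⋯ < t n < s (n + 1), so nothing is removed in the set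
differences; n > 0 makes both sets non-empty. -/
theorem interlaces (hp : PosChain p n t) (hh : PosChain h (n + 1) s) (hn : 0 < n)
    (hst : ∀ i < n, s (i + 1) < t (i + 1) ∧ t (i + 1) < s (i + 2)) :
    Interlaces h.roots.toFinset p.roots.toFinset := by
  have h1 : ∀ i j, i ≤ j → j < n → s (i + 1) < t (j + 1) := by
    intro i j hij hj
    rcases hij.lt_or_eq with h | rfl
    · exact (hh.lt (Nat.succ_lt_succ h) (by omega)).trans (hst j hj).1
    · exact (hst i hj).1
  have h2 : ∀ i j, j < i → i ≤ n → t (j + 1) < s (i + 1) := by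
    intro i j hij hi
    refine (hst j (by omega)).2.trans_le ?_
    rcases (Nat.succ_le_of_lt hij).lt_or_eq with h | h
    · exact (hh.lt (by omega) (by omega)).le
    · rw [← h]
  have hdisj : Disjoint h.roots.toFinset p.roots.toFinset := by
    rw [Finset.disjoint_left]
    intro x hx hy
    obtain ⟨i, hi, rfl⟩ := (hh.mem_roots_toFinset x).1 hx
    obtain ⟨j, hj, e⟩ := (hp.mem_roots_toFinset _).1 hy
    rcases le_or_gt i j with hij | hij
    · exact (h1 i j hij hj).ne e
    · exact (h2 i j hij (by omega)).ne' e
  rw [Interlaces, Finset.sdiff_eq_self_of_disjoint hdisj,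
    Finset.sdiff_eq_self_of_disjoint hdisj.symm]
  have hU : s 1 ∈ h.roots.toFinset := (hh.mem_roots_toFinset _).2 ⟨0, by omega, rfl⟩
  have hV : t 1 ∈ p.roots.toFinset := (hp.mem_roots_toFinset _).2 ⟨0, hn, rfl⟩
  refine ⟨⟨⟨_, hU⟩, ⟨_, hV⟩, ?_⟩, ?_, ?_⟩
  · refine (Finset.min'_le _ _ hU).trans_lt ((Finset.lt_min'_iff _ _).2 fun y hy => ?_)
    obtain ⟨j, hj, rfl⟩ := (hp.mem_roots_toFinset _).1 hy
    exact h1 0 j (Nat.zero_le j) hj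
  · rintro a b ⟨ha, hb, hab, -⟩
    obtain ⟨i, hi, rfl⟩ := (hh.mem_roots_toFinset a).1 ha
    obtain ⟨j, hj, rfl⟩ := (hh.mem_roots_toFinset b).1 hb
    have hij : i < j := by
      by_contra hc
      rcases (not_lt.1 hc).lt_or_eq with h | h
      · exact lt_asymm hab (hh.lt (Nat.succ_lt_succ h) hi)
      · rw [h] at hab; exact lt_irrefl _ hab
    exact ⟨t (i + 1), (hp.mem_roots_toFinset _).2 ⟨i, by omega, rfl⟩,
      h1 i i le_rfl (by omega), h2 j i hij (by omega)⟩
  · rintro a b ⟨ha, hb, hab, -⟩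
    obtain ⟨i, hi, rfl⟩ := (hp.mem_roots_toFinset a).1 ha
    obtain ⟨j, hj, rfl⟩ := (hp.mem_roots_toFinset b).1 hb
    have hij : i < j := by
      by_contra hc
      rcases (not_lt.1 hc).lt_or_eq with h | h
      · exact lt_asymm hab (hp.lt (Nat.succ_lt_succ h) hi)
      · rw [h] at hab; exact lt_irrefl _ hab
    exact ⟨s (j + 1), (hh.mem_roots_toFinset _).2 ⟨j, by omega, rfl⟩,
      h2 j i hij hj.le, h1 j j le_rfl hj⟩

/-- `lagShift a` with `a > 0` keeps the zeros positive and simple. -/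
theorem exists_lagShift (hp : PosChain p n t) {a : ℝ} (ha : 0 < a) :
    ∃ s, PosChain (lagShift a p) (n + 1) s := by
  have hm1 : ((X - C a) * p).Monic := (monic_X_sub_C a).mul hp.monic
  have hdeg1 : ((X - C a) * p).natDegree = n + 1 := by
    rw [(monic_X_sub_C a).natDegree_mul hp.monic, natDegree_X_sub_C, hp.natDegree, add_comm]
  have hdlt : (X * derivative p).degree < ((X - C a) * p).degree := by
    rw [degree_mul, degree_mul, degree_X, degree_X_sub_C]
    exact WithBot.add_lt_add_left WithBot.one_ne_bot (degree_derivative_lt hp.monic.ne_zero)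
  have hm : (lagShift a p).Monic := by
    rw [lagShift_apply]
    exact hm1.sub_of_left hdlt
  have hd : (lagShift a p).natDegree = n + 1 := by
    rw [lagShift_apply, ← hdeg1]
    exact natDegree_eq_of_degree_eq (degree_sub_eq_left_of_degree_lt hdlt)
  have hsign : ∀ i < n,
      (lagShift a p).eval (t (i + 1)) * (derivative p).eval (t (i + 1)) < 0 := by
    intro i hi
    have hroot : p.eval (t (i + 1)) = 0 := (hp.isRoot_iff _).2 ⟨i, hi, rfl⟩
    have hne : (derivative p).eval (t (i + 1)) ≠ 0 := by
      intro h0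
      have := hp.derivative_sign hi
      rw [h0, mul_zero] at this
      exact lt_irrefl _ this
    -- At a zero x of p the image is -x p'(x); its product with p'(x) is -x p'(x)² < 0.
    have h1 := mul_pos (hp.pos hi) (mul_self_pos.2 hne)
    rw [lagShift_apply, eval_sub, eval_mul, eval_mul, eval_X, hroot]
    linarith
  have h0 : 0 < (-1) ^ (n + 1) * (lagShift a p).eval 0 := by
    -- At 0 the image is -a p(0); here a > 0 is needed.
    have h1 := mul_pos ha hp.eval_zero_pos
    rw [lagShift_apply, pow_succ]
    simp only [eval_sub, eval_mul, eval_X, eval_C]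
    linarith
  obtain ⟨s, hs, -⟩ := hp.exists_interlacing hm hd hsign h0
  exact ⟨s, hs⟩

theorem exists_aeval_lagShift (hp : PosChain p n t) {ι : Type*} (S : Finset ι) (θ : ι → ℝ)
    {c : ℝ} (hθ : ∀ i ∈ S, θ i < c) :
    ∃ s, PosChain (aeval (lagShift c) (∏ i ∈ S, (X + C (θ i))) p) (n + S.card) s := by
  classical
  induction S using Finset.induction_on with
  | empty => exact ⟨t, by simpa using hp⟩
  | insert a S ha ih =>
    obtain ⟨s, hs⟩ := ih fun i hi => hθ i (Finset.mem_insert_of_mem hi)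
    have h1 := hs.exists_lagShift (sub_pos.2 (hθ a (Finset.mem_insert_self a S)))
    rw [Finset.prod_insert ha, Finset.card_insert_of_notMem ha, map_mul, Module.End.mul_apply,
      map_add, aeval_X, aeval_C, ← lagShift_sub]
    exact h1

end PosChain

/-! ### Zeros of the Laguerre polynomials and of the combinations -/

lemma exists_posChain_monicLaguerre {α : ℝ} (hα : -1 < α) (n : ℕ) :
    ∃ t, PosChain (monicLaguerre α n) n t := by
  induction n with
  | zero => exact ⟨0, rfl, fun i hi => absurd hi (Nat.not_lt_zero i), by simp [monicLaguerre_zero]⟩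
  | succ n ih =>
    obtain ⟨t, ht⟩ := ih
    rw [← lagShift_monicLaguerre]
    have hn : (0 : ℝ) ≤ n := Nat.cast_nonneg n
    exact ht.exists_lagShift (by linarith)

theorem exists_posChain_lagComb {α : ℝ} (hα : -1 < α) {K : ℕ} {θ : Fin K → ℝ}
    (hθ : ∀ i, θ i < α + 1) {n : ℕ} (hn : K ≤ n) :
    ∃ t, PosChain (lagComb α K (gammaCoeff θ) n) n t := by
  obtain ⟨m, rfl⟩ := Nat.exists_eq_add_of_le' hn
  obtain ⟨t, ht⟩ := exists_posChain_monicLaguerre hα m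
  have hm : (0 : ℝ) ≤ m := Nat.cast_nonneg m
  have h1 := ht.exists_aeval_lagShift Finset.univ θ (c := α + 1 + m)
    fun i _ => (hθ i).trans_le (by linarith)
  rw [Finset.card_univ, Fintype.card_fin] at h1
  rw [lagComb_eq_aeval]
  exact h1

/-! ### Estimates for the Laguerre recurrence -/

section Recurrence

variable {α z : ℝ} {a : ℕ → ℝ}

/-- Growth of a solution of the Laguerre recurrence to the right of `6 n`. -/
lemma laguerreRec_growth (h0 : a 0 = 1) (h1 : a 1 = z - (α + 1))
    (hrec : ∀ k : ℕ, a (k + 2) = (z - (2 * k + 3 + α)) * a (k + 1) - (k + 1) * (k + 1 + α) * a k)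
    (hα : -1 < α) {n : ℕ} (hn : |α| + 1 ≤ n) (hz : 6 * (n : ℝ) ≤ z) :
    ∀ j < n, 0 < a j ∧ 2 * n * a j ≤ a (j + 1) := by
  have hα1 := le_abs_self α
  have hα0 := abs_nonneg α
  intro j
  induction j with
  | zero =>
    intro _
    rw [h0, h1]
    constructor <;> linarith
  | succ j ih =>
    intro hj
    obtain ⟨hpos, hle⟩ := ih (by omega)
    have hjn : (j : ℝ) + 2 ≤ n := by exact_mod_cast hj
    have hj0 : (0 : ℝ) ≤ j := Nat.cast_nonneg j
    have hn0 : (1 : ℝ) ≤ n := by linarith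
    have hpos1 : 0 < a (j + 1) := lt_of_lt_of_le (by positivity) hle
    refine ⟨hpos1, ?_⟩
    rw [show j + 1 + 1 = j + 2 by rfl, hrec]
    -- The gain 3n from z ≥ 6n loses at most n to the a j term, leaving the factor 2n.
    have e1 : 3 * (n : ℝ) * a (j + 1) ≤ (z - (2 * j + 3 + α)) * a (j + 1) :=
      mul_le_mul_of_nonneg_right (by linarith) hpos1.le
    have e2 : ((j : ℝ) + 1) * (j + 1 + α) ≤ n * (2 * n) :=
      mul_le_mul (by linarith) (by linarith) (by linarith) (by linarith)
    have e3 : ((j : ℝ) + 1) * (j + 1 + α) * a j ≤ n * (2 * n) * a j :=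
      mul_le_mul_of_nonneg_right e2 hpos.le
    have e4 : (n : ℝ) * (2 * n * a j) ≤ n * a (j + 1) :=
      mul_le_mul_of_nonneg_left hle (by linarith)
    linarith

/-- Iterated growth with all but one factor 2n discarded; it makes a n dominate the lower terms of
q_n when z ≥ 6n. -/
lemma laguerreRec_le_sub (h0 : a 0 = 1) (h1 : a 1 = z - (α + 1))
    (hrec : ∀ k : ℕ, a (k + 2) = (z - (2 * k + 3 + α)) * a (k + 1) - (k + 1) * (k + 1 + α) * a k)
    (hα : -1 < α) {n : ℕ} (hn : |α| + 1 ≤ n) (hz : 6 * (n : ℝ) ≤ z) {j : ℕ} (hj : j < n) :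
    0 < a (n - (j + 1)) ∧ 2 * n * a (n - (j + 1)) ≤ a n := by
  have hg := laguerreRec_growth h0 h1 hrec hα hn hz
  have hn1 : (1 : ℝ) ≤ n := by linarith [abs_nonneg α]
  induction j with
  | zero =>
    have := hg (n - 1) (by omega)
    rwa [Nat.sub_add_cancel (by omega)] at this
  | succ j ih =>
    obtain ⟨hpos, hle⟩ := hg (n - (j + 1 + 1)) (by omega)
    rw [show n - (j + 1 + 1) + 1 = n - (j + 1) by omega] at hle
    refine ⟨hpos, le_trans ?_ (ih (by omega)).2⟩
    have h2 : a (n - (j + 1 + 1)) ≤ a (n - (j + 1)) := by nlinarith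
    exact mul_le_mul_of_nonneg_left h2 (by positivity)

/-- Two consecutive terms of the recurrence do not vanish together. -/
lemma laguerreRec_ne_zero (h0 : a 0 = 1)
    (hrec : ∀ k : ℕ, a (k + 2) = (z - (2 * k + 3 + α)) * a (k + 1) - (k + 1) * (k + 1 + α) * a k)
    (hα : -1 < α) (k : ℕ) : ¬ (a (k + 1) = 0 ∧ a k = 0) := by
  induction k with
  | zero => rintro ⟨-, h⟩; rw [h0] at h; exact one_ne_zero h
  | succ k ih =>
    rintro ⟨h2, h1⟩
    refine ih ⟨h1, ?_⟩
    have h3 := hrec k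
    have hk : (0 : ℝ) ≤ k := Nat.cast_nonneg k
    rw [show k + 2 = k + 1 + 1 by rfl, h2, h1] at h3
    have h4 : ((k : ℝ) + 1) * (k + 1 + α) ≠ 0 :=
      mul_ne_zero (by linarith) (by linarith)
    have h5 : ((k : ℝ) + 1) * (k + 1 + α) * a k = 0 := by linarith
    exact (mul_eq_zero.1 h5).resolve_left h4

/-- Backward control of the rescaled terms `n ^ j * a (n - j)`. -/
lemma laguerreRec_backward
    (hrec : ∀ k : ℕ, a (k + 2) = (z - (2 * k + 3 + α)) * a (k + 1) - (k + 1) * (k + 1 + α) * a k)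
    (hα : -1 < α) {n K : ℕ} (hn : 4 * |α| + 2 ≤ n) (hK : 2 * (K + 1) ≤ n)
    (hz0 : 0 < z) (hz : z < 6 * n) {j : ℕ} (hj : j ≤ K + 1) :
    (n : ℝ) ^ j * |a (n - j)| ≤ 80 ^ j * (|a n| + n * |a (n - 1)|) := by
  have hα1 := le_abs_self α
  have hα2 := neg_abs_le α
  have hα0 := abs_nonneg α
  have hn0 : (0 : ℝ) < n := by linarith
  -- The recurrence has order two, so two consecutive bounds are carried together.
  have key : ∀ j, (j ≤ K + 1 → (n : ℝ) ^ j * |a (n - j)| ≤ 80 ^ j * (|a n| + n * |a (n - 1)|)) ∧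
      (j + 1 ≤ K + 1 → (n : ℝ) ^ (j + 1) * |a (n - (j + 1))|
        ≤ 80 ^ (j + 1) * (|a n| + n * |a (n - 1)|)) := by
    have hM0 : 0 ≤ |a n| := abs_nonneg _
    have hM1 : 0 ≤ n * |a (n - 1)| := by positivity
    intro j
    induction j with
    | zero =>
      refine ⟨fun _ => ?_, fun _ => ?_⟩
      · simpa using hM1
      · rw [zero_add, pow_one, pow_one]
        linarith
    | succ j ih =>
      refine ⟨ih.2, fun hj => ?_⟩
      have i0 := ih.1 (by omega)
      have i1 := ih.2 (by omega)
      obtain ⟨r, hr⟩ : ∃ r, n = r + (j + 2) := Nat.exists_eq_add_of_le' (by omega)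
      have e0 : n - j = r + 2 := by omega
      have e1 : n - (j + 1) = r + 1 := by omega
      have e2 : n - (j + 1 + 1) = r := by omega
      rw [e0] at i0
      rw [e1] at i1
      rw [e2]
      have hrn : (n : ℝ) ≤ 2 * (r + 1) := by
        have : n ≤ 2 * (r + 1) := by omega
        exact_mod_cast this
      have hrn2 : (r : ℝ) + 2 ≤ n := by
        have : r + 2 ≤ n := by omega
        exact_mod_cast this
      have hr0 : (0 : ℝ) ≤ r := Nat.cast_nonneg r
      -- r + 1 ≥ n/2 since j + 2 ≤ K + 1 ≤ n/2, and |α| ≤ n/4 leaves r + 1 + α ≥ n/4.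
      have c1 : (n : ℝ) ^ 2 / 8 ≤ (r + 1) * (r + 1 + α) := by
        have : (n : ℝ) / 2 * (n / 4) ≤ (r + 1) * (r + 1 + α) :=
          mul_le_mul (by linarith) (by linarith) (by linarith) (by linarith)
        linarith
      have c2 : |z - (2 * r + 3 + α)| ≤ 9 * n := abs_le.2 ⟨by linarith, by linarith⟩
      have c3 : ((r : ℝ) + 1) * (r + 1 + α) * a r
          = (z - (2 * r + 3 + α)) * a (r + 1) - a (r + 2) := by
        rw [hrec r]; ring
      have c4 : (n : ℝ) ^ 2 / 8 * |a r| ≤ 9 * n * |a (r + 1)| + |a (r + 2)| := by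
        calc (n : ℝ) ^ 2 / 8 * |a r| ≤ (r + 1) * (r + 1 + α) * |a r| :=
              mul_le_mul_of_nonneg_right c1 (abs_nonneg _)
          _ = |(z - (2 * r + 3 + α)) * a (r + 1) - a (r + 2)| := by
              rw [← c3, abs_mul, abs_of_nonneg ((by positivity : (0 : ℝ) ≤ n ^ 2 / 8).trans c1)]
          _ ≤ |(z - (2 * r + 3 + α)) * a (r + 1)| + |a (r + 2)| := abs_sub _ _
          _ ≤ 9 * n * |a (r + 1)| + |a (r + 2)| := by
              rw [abs_mul]
              gcongr
      -- Here 72 + 8 = 80 is the base of the bound.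
      have c5 : (n : ℝ) ^ (j + 1 + 1) * |a r|
          ≤ 72 * (n ^ (j + 1) * |a (r + 1)|) + 8 * (n ^ j * |a (r + 2)|) := by
        have := mul_le_mul_of_nonneg_left c4 (by positivity : (0 : ℝ) ≤ 8 * n ^ j)
        calc (n : ℝ) ^ (j + 1 + 1) * |a r| = 8 * n ^ j * (n ^ 2 / 8 * |a r|) := by ring
          _ ≤ _ := this
          _ = _ := by ring
      have c6 : (80 : ℝ) ^ j * (|a n| + n * |a (n - 1)|) ≥ 0 := by positivity
      rw [pow_succ (80 : ℝ)] at i1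
      rw [pow_succ (80 : ℝ), pow_succ (80 : ℝ)]
      linarith
  exact (key j).1 hj

/-- At a zero of `∑ γ_j a_{n-j}` all rescaled terms are controlled by `n * |a (n - 1)|`. -/
lemma laguerreRec_bounds
    (hrec : ∀ k : ℕ, a (k + 2) = (z - (2 * k + 3 + α)) * a (k + 1) - (k + 1) * (k + 1 + α) * a k)
    (hα : -1 < α) {n K : ℕ} {γ : ℕ → ℝ} (hn : 4 * |α| + 2 ≤ n) (hK : 2 * (K + 1) ≤ n)
    (hn2 : 2 * ((∑ j ∈ Finset.range K, |γ (j + 1)|) * 80 ^ (K + 1)) ≤ n)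
    (hz0 : 0 < z) (hz : z < 6 * n)
    (hF : a n + ∑ j ∈ Finset.range K, γ (j + 1) * a (n - (j + 1)) = 0) :
    (∀ j ≤ K + 1, (n : ℝ) ^ j * |a (n - j)| ≤ 80 ^ (K + 1) * (2 * (n * |a (n - 1)|))) ∧
    n * |a n| ≤ (∑ j ∈ Finset.range K, |γ (j + 1)|) * 80 ^ (K + 1) * (2 * (n * |a (n - 1)|)) := by
  set G := ∑ j ∈ Finset.range K, |γ (j + 1)| with hG
  set D : ℝ := 80 ^ (K + 1) with hD
  set M := |a n| + n * |a (n - 1)| with hM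
  have hn1 : (1 : ℝ) ≤ n := by linarith [abs_nonneg α]
  have hM0 : 0 ≤ M := by positivity
  have hb : ∀ j ≤ K + 1, (n : ℝ) ^ j * |a (n - j)| ≤ D * M := fun j hj =>
    (laguerreRec_backward hrec hα hn hK hz0 hz hj).trans
      (mul_le_mul_of_nonneg_right (pow_le_pow_right₀ (by norm_num) hj) hM0)
  have h1 : n * |a n| ≤ G * (D * M) := by
    have : a n = -∑ j ∈ Finset.range K, γ (j + 1) * a (n - (j + 1)) := by linarith
    rw [this, abs_neg, hG, Finset.sum_mul]
    refine (mul_le_mul_of_nonneg_left (Finset.abs_sum_le_sum_abs _ _) (by linarith)).trans ?_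
    rw [Finset.mul_sum]
    refine Finset.sum_le_sum fun j hj => ?_
    have hj' := Finset.mem_range.1 hj
    rw [abs_mul, mul_left_comm]
    refine mul_le_mul_of_nonneg_left (le_trans ?_ (hb (j + 1) (by omega))) (abs_nonneg _)
    refine mul_le_mul_of_nonneg_right ?_ (abs_nonneg _)
    exact le_self_pow₀ hn1 (Nat.succ_ne_zero j)
  -- For n ≥ 2GD, a n takes at most half of M and is absorbed.
  have h2 : |a n| ≤ M / 2 := by
    have h3 : 2 * (G * D) * M ≤ n * M := mul_le_mul_of_nonneg_right hn2 hM0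
    have h4 : (n : ℝ) * |a n| ≤ n * (M / 2) := by linarith
    exact le_of_mul_le_mul_left h4 (by linarith)
  have h3 : M ≤ 2 * (n * |a (n - 1)|) := by linarith
  have hG0 : 0 ≤ G := Finset.sum_nonneg fun _ _ => abs_nonneg _
  have hD0 : 0 ≤ D := by positivity
  refine ⟨fun j hj => (hb j hj).trans (mul_le_mul_of_nonneg_left h3 hD0), h1.trans ?_⟩
  rw [← mul_assoc]
  exact mul_le_mul_of_nonneg_left h3 (mul_nonneg hG0 hD0)

/-- The sign condition behind the interlacing: `b` is the sequence of the `z L_k'(z)`. -/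
lemma laguerreRec_mul_neg {b : ℕ → ℝ} (h0 : a 0 = 1)
    (hrec : ∀ k : ℕ, a (k + 2) = (z - (2 * k + 3 + α)) * a (k + 1) - (k + 1) * (k + 1 + α) * a k)
    (hder : ∀ k : ℕ, b (k + 1) = (k + 1) * a (k + 1) + (k + 1) * (k + 1 + α) * a k)
    (hα : -1 < α) {n K : ℕ} {γ : ℕ → ℝ} (hn : 4 * |α| + 2 ≤ n) (hK : 2 * (K + 1) ≤ n)
    (hn2 : 20 * ((∑ j ∈ Finset.range K, |γ (j + 1)|) * 80 ^ (K + 1)) + |α| < n)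
    (hz0 : 0 < z) (hz : z < 6 * n)
    (hF : a n + ∑ j ∈ Finset.range K, γ (j + 1) * a (n - (j + 1)) = 0) :
    (a (n + 1) + ∑ j ∈ Finset.range K, γ (j + 1) * a (n - j)) *
      (b n + ∑ j ∈ Finset.range K, γ (j + 1) * b (n - (j + 1))) < 0 := by
  have hα1 := le_abs_self α
  have hα2 := neg_abs_le α
  have hα0 := abs_nonneg α
  have hn1 : (1 : ℝ) ≤ n := by linarith
  have hGD0 : 0 ≤ (∑ j ∈ Finset.range K, |γ (j + 1)|) * 80 ^ (K + 1) :=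
    mul_nonneg (Finset.sum_nonneg fun _ _ => abs_nonneg _) (by positivity)
  obtain ⟨hb, hl0⟩ := laguerreRec_bounds hrec hα hn hK (by linarith) hz0 hz hF
  obtain ⟨m, rfl⟩ : ∃ m, n = m + 1 := Nat.exists_eq_add_of_le' (by omega)
  rw [Nat.add_sub_cancel] at hb hl0
  set N : ℝ := ((m + 1 : ℕ) : ℝ) with hN
  have hNm : (m : ℝ) + 1 = N := by rw [hN]; push_cast; ring
  set G := ∑ j ∈ Finset.range K, |γ (j + 1)| with hG
  set D : ℝ := 80 ^ (K + 1) with hD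
  have hD0 : 0 ≤ D := by positivity
  -- If a m vanished, the bound would force a (m + 1) = 0 too.
  have hm0 : a m ≠ 0 := by
    intro h
    refine laguerreRec_ne_zero h0 hrec hα m ⟨?_, h⟩
    rw [h, abs_zero, mul_zero, mul_zero, mul_zero] at hl0
    exact abs_eq_zero.1 (le_antisymm (le_of_mul_le_mul_left (by simpa using hl0)
      (by linarith : (0 : ℝ) < N)) (abs_nonneg _))
  set w := N * |a m| with hw
  have hwabs : |N * a m| = w := by rw [abs_mul, abs_of_pos (by linarith : (0 : ℝ) < N)]
  have hw0 : 0 < w := mul_pos (by linarith) (abs_pos.2 hm0)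
  have hαw : |α * a m| ≤ |α| * w := by
    rw [abs_mul]
    refine mul_le_mul_of_nonneg_left ?_ hα0
    exact le_mul_of_one_le_left (abs_nonneg _) hn1
  have hsum : ∀ c : ℕ → ℝ, ∀ B : ℝ, (∀ j < K, |c j| ≤ B) →
      |∑ j ∈ Finset.range K, γ (j + 1) * c j| ≤ G * B := by
    intro c B hc
    refine (Finset.abs_sum_le_sum_abs _ _).trans ?_
    rw [hG, Finset.sum_mul]
    refine Finset.sum_le_sum fun j hj => ?_
    rw [abs_mul]
    exact mul_le_mul_of_nonneg_left (hc j (Finset.mem_range.1 hj)) (abs_nonneg _)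
  have hA : |∑ j ∈ Finset.range K, γ (j + 1) * a (m + 1 - j)| ≤ G * (D * (2 * w)) := by
    refine hsum _ _ fun j hj => ?_
    refine le_trans ?_ (hb j (by omega))
    exact le_mul_of_one_le_left (abs_nonneg _) (one_le_pow₀ hn1)
  have hB : |∑ j ∈ Finset.range K, γ (j + 1) * b (m + 1 - (j + 1))| ≤ G * (3 * (D * (2 * w))) := by
    refine hsum _ _ fun j hj => ?_
    obtain ⟨r, hr⟩ : ∃ r, m = r + (j + 1) := Nat.exists_eq_add_of_le' (by omega)
    have e1 : m + 1 - (j + 1) = r + 1 := by omega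
    have b1 := hb (j + 1) (by omega)
    have b2 := hb (j + 2) (by omega)
    rw [e1] at b1 ⊢
    rw [show m + 1 - (j + 2) = r by omega] at b2
    have hrN : (r : ℝ) + 1 ≤ N := by
      rw [← hNm, hr]; push_cast; linarith [(Nat.cast_nonneg j : (0 : ℝ) ≤ j)]
    have hr0 : (0 : ℝ) ≤ r := Nat.cast_nonneg r
    have hN0 : (0 : ℝ) ≤ N := by linarith
    rw [hder]
    have c1 : |((r : ℝ) + 1) * a (r + 1)| ≤ D * (2 * w) := by
      rw [abs_mul, abs_of_pos (by linarith : (0 : ℝ) < r + 1)]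
      refine (mul_le_mul_of_nonneg_right ?_ (abs_nonneg _)).trans b1
      exact hrN.trans (le_self_pow₀ hn1 (Nat.succ_ne_zero j))
    have c2 : |((r : ℝ) + 1) * (r + 1 + α) * a r| ≤ 2 * (D * (2 * w)) := by
      have hp : (0 : ℝ) ≤ (r + 1) * (r + 1 + α) := mul_nonneg (by linarith) (by linarith)
      rw [abs_mul, abs_of_nonneg hp]
      have c3 : ((r : ℝ) + 1) * (r + 1 + α) ≤ N * (2 * N) :=
        mul_le_mul hrN (by linarith) (by linarith) hN0
      have c4 : N ^ 2 ≤ N ^ (j + 2) := pow_le_pow_right₀ hn1 (by omega)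
      calc ((r : ℝ) + 1) * (r + 1 + α) * |a r| ≤ 2 * N ^ (j + 2) * |a r| :=
            mul_le_mul_of_nonneg_right (by linarith) (abs_nonneg _)
        _ = 2 * (N ^ (j + 2) * |a r|) := by ring
        _ ≤ _ := by linarith
    exact (abs_add_le _ _).trans (by linarith)
  have hC : |(z - (2 * m + 3 + α)) * a (m + 1)| ≤ 9 * (G * D * (2 * w)) := by
    have c2 : |z - (2 * m + 3 + α)| ≤ 9 * N := abs_le.2 ⟨by linarith, by linarith⟩
    rw [abs_mul]
    exact (mul_le_mul_of_nonneg_right c2 (abs_nonneg _)).trans (by linarith)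
  have hNl : |N * a (m + 1)| ≤ G * D * (2 * w) := by
    rwa [abs_mul, abs_of_pos (by linarith : (0 : ℝ) < N)]
  -- The errors in q_{n+1}(z) total 18 + 2 = 20 times GDw, plus |α|w; those in z q_n'(z) total 2 + 6
  -- = 8 times GDw, plus |α|w.
  have hlt : 20 * (G * D) * w + |α| * w < N * w := by
    rw [← add_mul]
    exact mul_lt_mul_of_pos_right hn2 hw0
  have hNw : |N * (N * a m)| = N * w := by
    rw [abs_mul, hwabs, abs_of_pos (by linarith : (0 : ℝ) < N)]
  have hNα : |N * (α * a m)| ≤ |α| * w := by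
    rw [mul_left_comm, abs_mul, hwabs]
  have E1 : a (m + 1 + 1) + ∑ j ∈ Finset.range K, γ (j + 1) * a (m + 1 - j)
      = -(N * (N * a m)) + ((z - (2 * m + 3 + α)) * a (m + 1) - N * (α * a m)
        + ∑ j ∈ Finset.range K, γ (j + 1) * a (m + 1 - j)) := by
    rw [hrec, hNm]; ring
  have E2 : b (m + 1) + ∑ j ∈ Finset.range K, γ (j + 1) * b (m + 1 - (j + 1))
      = N * (N * a m) + (N * a (m + 1) + N * (α * a m)
        + ∑ j ∈ Finset.range K, γ (j + 1) * b (m + 1 - (j + 1))) := by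
    rw [hder, hNm]; ring
  rw [E1, E2]
  rw [abs_le] at hA hB hC hNl hNα
  rcases abs_cases (N * (N * a m)) with ⟨h, -⟩ | ⟨h, -⟩
  · exact mul_neg_of_neg_of_pos (by linarith) (by linarith)
  · exact mul_neg_of_pos_of_neg (by linarith) (by linarith)

end Recurrence

/-! ### Interlacing for large n -/

lemma gammaCoeff_zero {K : ℕ} (θ : Fin K → ℝ) : gammaCoeff θ 0 = 1 := by
  have hm : (∏ i, (X - C (θ i))).Monic := monic_prod_of_monic _ _ fun i _ => monic_X_sub_C _
  have hd : (∏ i, (X - C (θ i))).natDegree = K := by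
    rw [natDegree_prod_of_monic _ _ fun i _ => monic_X_sub_C (θ i)]
    simp
  have h1 := hm.coeff_natDegree
  rw [hd] at h1
  simp [gammaCoeff, Phi, Nat.stirlingSecond_self, h1]

lemma lagComb_eq_add_sum (α : ℝ) {K : ℕ} (θ : Fin K → ℝ) (n : ℕ) :
    lagComb α K (gammaCoeff θ) n = monicLaguerre α n
      + ∑ j ∈ Finset.range K, C (gammaCoeff θ (j + 1)) * monicLaguerre α (n - (j + 1)) := by
  rw [lagComb, Finset.sum_range_succ', gammaCoeff_zero, C_1, one_mul, Nat.sub_zero, add_comm]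

/-- For large `n`, `q_{n+1}` and `q_n'` have opposite signs at the positive zeros of `q_n`. -/
theorem exists_eval_lagComb_mul_neg {α : ℝ} (hα : -1 < α) {K : ℕ} (θ : Fin K → ℝ) :
    ∃ N : ℕ, ∀ n : ℕ, N ≤ n → ∀ z : ℝ, 0 < z → (lagComb α K (gammaCoeff θ) n).eval z = 0 →
      (lagComb α K (gammaCoeff θ) (n + 1)).eval z
        * (derivative (lagComb α K (gammaCoeff θ) n)).eval z < 0 := by
  set G := ∑ j ∈ Finset.range K, |gammaCoeff θ (j + 1)| with hG
  have hG0 : 0 ≤ G := Finset.sum_nonneg fun _ _ => abs_nonneg _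
  have hGD : G ≤ G * 80 ^ (K + 1) := le_mul_of_one_le_right hG0 (one_le_pow₀ (by norm_num))
  obtain ⟨N1, hN1⟩ := exists_nat_gt (20 * (G * 80 ^ (K + 1)) + 4 * |α| + 2)
  refine ⟨N1 + 2 * (K + 1), fun n hn z hz0 hroot => ?_⟩
  have hnN : (N1 : ℝ) ≤ n := by exact_mod_cast (by omega : N1 ≤ n)
  have hα0 := abs_nonneg α
  have hb : (20 * (G * 80 ^ (K + 1)) + 4 * |α| + 2) < n := hN1.trans_le hnN
  set a : ℕ → ℝ := fun k => (monicLaguerre α k).eval z with ha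
  have h0 : a 0 = 1 := by simp [ha, monicLaguerre_zero]
  have h1 : a 1 = z - (α + 1) := by simp [ha, monicLaguerre_one]
  have hrec : ∀ k : ℕ,
      a (k + 2) = (z - (2 * k + 3 + α)) * a (k + 1) - (k + 1) * (k + 1 + α) * a k := by
    intro k
    simp only [ha, monicLaguerre_add_two, eval_sub, eval_mul, eval_X, eval_C]
  have hder : ∀ k : ℕ, z * (derivative (monicLaguerre α (k + 1))).eval z
      = (k + 1) * a (k + 1) + (k + 1) * (k + 1 + α) * a k := by
    intro k
    have := congrArg (eval z) (X_mul_derivative_monicLaguerre α k)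
    simpa only [eval_mul, eval_add, eval_X, eval_C] using this
  have hF : a n + ∑ j ∈ Finset.range K, gammaCoeff θ (j + 1) * a (n - (j + 1)) = 0 := by
    rw [← hroot, lagComb_eq_add_sum, eval_add, eval_finsetSum]
    simp only [eval_mul, eval_C, ha]
  -- Beyond 6n the lower terms sum to at most G a_n / (2n) < a_n, so q_n cannot vanish there.
  have hz : z < 6 * n := by
    by_contra hz
    rw [not_lt] at hz
    have hnα : |α| + 1 ≤ n := by linarith
    have hsum : |∑ j ∈ Finset.range K, gammaCoeff θ (j + 1) * a (n - (j + 1))| * (2 * n)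
        ≤ G * a n := by
      refine (mul_le_mul_of_nonneg_right (Finset.abs_sum_le_sum_abs _ _) (by linarith)).trans ?_
      rw [hG, Finset.sum_mul, Finset.sum_mul]
      refine Finset.sum_le_sum fun j hj => ?_
      have hj' := Finset.mem_range.1 hj
      obtain ⟨g1, g2⟩ := laguerreRec_le_sub h0 h1 hrec hα hnα hz (by omega : j < n)
      rw [abs_mul, abs_of_pos g1, mul_assoc, mul_comm (a _)]
      exact mul_le_mul_of_nonneg_left g2 (abs_nonneg _)
    have hpos : 0 < a n := by
      obtain ⟨g1, g2⟩ := laguerreRec_le_sub h0 h1 hrec hα hnα hz (by omega : 0 < n)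
      exact lt_of_lt_of_le (mul_pos (by linarith) g1) g2
    rw [show (∑ j ∈ Finset.range K, gammaCoeff θ (j + 1) * a (n - (j + 1))) = -a n by linarith,
      abs_neg, abs_of_pos hpos] at hsum
    have : a n * G < a n * (2 * n) := mul_lt_mul_of_pos_left (by linarith) hpos
    linarith
  have key := laguerreRec_mul_neg (b := fun k => z * (derivative (monicLaguerre α k)).eval z)
    (n := n) (K := K) (γ := gammaCoeff θ) h0 hrec hder hα (by linarith) (by omega)
    (by linarith) hz0 hz hF
  have e1 : (lagComb α K (gammaCoeff θ) (n + 1)).eval z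
      = a (n + 1) + ∑ j ∈ Finset.range K, gammaCoeff θ (j + 1) * a (n - j) := by
    rw [lagComb_eq_add_sum, eval_add, eval_finsetSum]
    simp only [eval_mul, eval_C, ha, Nat.add_sub_add_right]
  have e2 : z * (derivative (lagComb α K (gammaCoeff θ) n)).eval z
      = z * (derivative (monicLaguerre α n)).eval z + ∑ j ∈ Finset.range K,
        gammaCoeff θ (j + 1) * (z * (derivative (monicLaguerre α (n - (j + 1)))).eval z) := by
    rw [lagComb_eq_add_sum, derivative_add, derivative_sum, eval_add, eval_finsetSum, mul_add,
      Finset.mul_sum]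
    congr 1
    refine Finset.sum_congr rfl fun j _ => ?_
    rw [derivative_C_mul, eval_mul, eval_C]
    ring
  rw [← e1, ← e2, mul_left_comm] at key
  exact (pos_iff_neg_of_mul_neg key).1 hz0

theorem corollary3p8 (α : ℝ) (hα : -1 < α) (K : ℕ) (hK : 0 < K)
    (θ : Fin K → ℝ) (hθ : ∀ i, θ i < α + 1) :
    polyQ K (gammaCoeff θ) = ∏ i, (X - C (θ i)) ∧
    (∀ n : ℕ, K ≤ n → ZerosPositiveSimple (lagComb α K (gammaCoeff θ) n)) ∧
    (∃ N : ℕ, ∀ n : ℕ, N ≤ n →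
      Interlaces (lagComb α K (gammaCoeff θ) (n + 1)).roots.toFinset
        (lagComb α K (gammaCoeff θ) n).roots.toFinset) := by
  refine ⟨polyQ_gammaCoeff θ, fun n hn => ?_, ?_⟩
  · obtain ⟨t, ht⟩ := exists_posChain_lagComb hα hθ hn
    exact ht.zerosPositiveSimple
  · obtain ⟨N, hN⟩ := exists_eval_lagComb_mul_neg hα θ
    refine ⟨N + K, fun n hn => ?_⟩
    obtain ⟨t, ht⟩ := exists_posChain_lagComb hα hθ (by omega : K ≤ n)
    obtain ⟨s, hs⟩ := exists_posChain_lagComb hα hθ (by omega : K ≤ n + 1)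
    -- The list s supplies only degree, monicity and the sign at 0; u relists the same zeros
    -- together with their position among the t i.
    obtain ⟨u, hu, hut⟩ := ht.exists_interlacing hs.monic hs.natDegree
      (fun i hi => hN n (by omega) _ (ht.pos hi) ((ht.isRoot_iff _).2 ⟨i, hi, rfl⟩))
      hs.eval_zero_pos
    exact ht.interlaces hu (by omega) hut
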